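/- Let $X$ be a separable real Banach space with a predual $X_*$ (so $X\cong (X_*)^*$ isometrically), $Y$ a separable real Hilbert space, $A:X\to Y$ linear, bounded and weak*-to-weak continuous, $f\in Y$, $\alpha>0$, and $S\subset\mathbb R^d$ a non-empty compact set. Let $J:X\times S\to[0,\infty]$ be Borel measurable and such that (H1) for every $s\in S$, $J(\cdot,s)$ is proper, convex and positively one-homogeneous, i.e. $J(\lambda v,s)=\lambda J(v,s)$ for all $\lambda\ge 0$, $v\in X$ (with $0\cdot\infty=0$); (H2) $J$ is sequentially lower semicontinuous on $X\times S$, where $X$ carries the weak* topology; (H3) there is $C>0$ with $\|v\|_X\le C\,J(v,s)$ for all $v\in X$, $s\in S$. Let $\mathcal M_+(S)$ be the set of finite positive Borel measures on $S$. For $\sigma\in\mathcal M_+(S)$, let $L^1((S,\sigma);X)$ be the Bochner space, and put $\mathcal I_\sigma u=\int_S u\,d\sigma$ for $u\in L^1((S,\sigma);X)$ and $$R(v,\sigma)=\inf\Big\{\int_S J(u(s),s)\,d\sigma(s)\;:\;u\in L^1((S,\sigma);X),\ \mathcal I_\sigma u=v\Big\}\qquad(v\in X,\ \inf\emptyset=\infty).$$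 Let $\mathcal M(S;X)$ be the space of $X$-valued countably additive Borel measures $\mu$ on $S$ with finite variation measure $|\mu|$. Every $\mu\in\mathcal M(S;X)$ has a unique density $\frac{\mu}{|\mu|}\in L^1((S,|\mu|);X)$, that is, $\mu(E)=\int_E\frac{\mu}{|\mu|}\,d|\mu|$ for all Borel $E\subset S$. Moreover: 1. There exists $\mu\in\mathcal M(S;X)$ minimizing $$\tfrac12\|A\mu(S)-f\|_Y^2+\alpha\int_S J\Big(\tfrac{\mu}{|\mu|}(s),s\Big)\,d|\mu|(s)\quad\text{over }\mathcal M(S;X).$$ 2. There exists a pair $(u,\sigma)$ with $\sigma\in\mathcal M_+(S)$ and $u\in L^1((S,\sigma);X)$ minimizing $$\tfrac12\|A\mathcal I_\sigma u-f\|_Y^2+\alpha\int_S J(u(s),s)\,d\sigma(s)\quad\text{over all such pairs}.$$ 3. Consequently, for every pair $(u,\sigma)$ as in 2, the pair $(\mathcal I_\sigma u,\sigma)$ minimizes $$\tfrac12\|Av-f\|_Y^2+\alpha R(v,\sigma)\quad\text{over }(v,\sigma)\in X\times\mathcal M_+(S).$$ -/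

import Mathlib

open MeasureTheory Filter Set
open scoped ENNReal NNReal Topology

noncomputable section

namespace InfConv

/-- `v ∈ X` regarded as an element of the dual of the predual `P`, with the weak* topology
`σ(X, P)`. -/
def weakStar {X P : Type*} [NormedAddCommGroup X] [NormedSpace ℝ X]
    [NormedAddCommGroup P] [NormedSpace ℝ P] (ι : X ≃ₗᵢ[ℝ] StrongDual ℝ P) (v : X) :
    WeakDual ℝ P :=
  StrongDual.toWeakDual (ι v)

/-- `A : X → Y` is continuous from the weak* topology of `X` to the weak topology of `Y`. -/
def IsWeakStarWeakContinuous {X P Y : Type*} [NormedAddCommGroup X] [NormedSpace ℝ X]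
    [NormedAddCommGroup P] [NormedSpace ℝ P] [NormedAddCommGroup Y] [NormedSpace ℝ Y]
    (ι : X ≃ₗᵢ[ℝ] StrongDual ℝ P) (A : X →L[ℝ] Y) : Prop :=
  Continuous fun x : WeakDual ℝ P => toWeakSpace ℝ Y (A (ι.symm (WeakDual.toStrongDual x)))

/-- `J(·, s)` is proper, convex and positively one-homogeneous for every `s`
(with `0 · ∞ = 0`, so that `J(0, s) = 0`). -/
def IsConvexHomogeneous {X S : Type*} [NormedAddCommGroup X] [NormedSpace ℝ X]
    (J : X × S → ℝ≥0∞) : Prop :=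
  ∀ s : S, (∃ v : X, J (v, s) ≠ ∞) ∧
    ConvexOn ℝ≥0 univ (fun v : X => J (v, s)) ∧
    ∀ (c : ℝ≥0) (v : X), J (c • v, s) = c * J (v, s)

/-- `J` is sequentially lower semicontinuous on `X × S`, where `X` carries the weak* topology. -/
def IsWeakStarSeqLSC {X P S : Type*} [NormedAddCommGroup X] [NormedSpace ℝ X]
    [NormedAddCommGroup P] [NormedSpace ℝ P] [TopologicalSpace S]
    (ι : X ≃ₗᵢ[ℝ] StrongDual ℝ P) (J : X × S → ℝ≥0∞) : Prop :=
  ∀ (v : ℕ → X) (s : ℕ → S) (v₀ : X) (s₀ : S),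
    Tendsto (fun n => weakStar ι (v n)) atTop (𝓝 (weakStar ι v₀)) →
    Tendsto s atTop (𝓝 s₀) →
    J (v₀, s₀) ≤ liminf (fun n => J (v n, s n)) atTop

/-- `‖v‖ ≤ C J(v, s)` for all `v` and `s`, with one constant `C > 0`. -/
def IsCoercive {X S : Type*} [NormedAddCommGroup X] (J : X × S → ℝ≥0∞) : Prop :=
  ∃ C : ℝ≥0, 0 < C ∧ ∀ (v : X) (s : S), ‖v‖ₑ ≤ C * J (v, s)

/-- The integral functional `F_σ(u) = ∫_S J(u(s), s) dσ(s)` on `L¹((S,σ);X)`. -/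
def integralFunctional {X S : Type*} [NormedAddCommGroup X] [MeasurableSpace S]
    (J : X × S → ℝ≥0∞) (σ : FiniteMeasure S) (u : Lp X 1 (σ : Measure S)) : ℝ≥0∞ :=
  ∫⁻ s, J (u s, s) ∂(σ : Measure S)

/-- `I_σ u = ∫_S u(s) dσ(s)`, a Bochner integral. -/
def integralOp {X S : Type*} [NormedAddCommGroup X] [NormedSpace ℝ X] [MeasurableSpace S]
    (σ : FiniteMeasure S) (u : Lp X 1 (σ : Measure S)) : X :=
  ∫ s, u s ∂(σ : Measure S)

/-- The infinite infimal convolution functional `R(v, σ)`; it is `∞` if no `u` satisfies the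
constraint. -/
def infConv {X S : Type*} [NormedAddCommGroup X] [NormedSpace ℝ X] [MeasurableSpace S]
    (J : X × S → ℝ≥0∞) (v : X) (σ : FiniteMeasure S) : ℝ≥0∞ :=
  ⨅ (u : Lp X 1 (σ : Measure S)) (_ : integralOp σ u = v), integralFunctional J σ u

/-- The space `M(S; X)` of `X`-valued measures of finite total variation. -/
def VMeasure (S X : Type*) [MeasurableSpace S] [NormedAddCommGroup X] : Type _ :=
  {μ : VectorMeasure S X // μ.variation univ < ∞}

/-- The variation `|μ|`, a finite positive measure. -/
def VMeasure.absMeasure {S X : Type*} [MeasurableSpace S] [NormedAddCommGroup X]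
    (μ : VMeasure S X) : FiniteMeasure S :=
  ⟨μ.1.variation, ⟨μ.2⟩⟩

/-- `u ∈ L¹((S,|μ|);X)` is a density of `μ` with respect to `|μ|`. -/
def IsPolarDensity {S X : Type*} [MeasurableSpace S] [NormedAddCommGroup X] [NormedSpace ℝ X]
    (μ : VMeasure S X) (u : Lp X 1 (μ.absMeasure : Measure S)) : Prop :=
  ∀ E : Set S, MeasurableSet E → μ.1 E = ∫ s in E, u s ∂(μ.absMeasure : Measure S)

open Classical in
/-- The density `μ / |μ|`. -/
def polarDensity {S X : Type*} [MeasurableSpace S] [NormedAddCommGroup X] [NormedSpace ℝ X]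
    (μ : VMeasure S X) : Lp X 1 (μ.absMeasure : Measure S) :=
  if h : ∃ u, IsPolarDensity μ u then h.choose else 0

/-- The lifted functional `F̂(μ) = ∫_S J((μ/|μ|)(s), s) d|μ|(s)`. -/
def liftedFunctional {S X : Type*} [MeasurableSpace S] [NormedAddCommGroup X] [NormedSpace ℝ X]
    (J : X × S → ℝ≥0∞) (μ : VMeasure S X) : ℝ≥0∞ :=
  ∫⁻ s, J (polarDensity μ s, s) ∂(μ.absMeasure : Measure S)

/-- The fidelity term `½ ‖A v - f‖²`. -/
def fidelity {X Y : Type*} [NormedAddCommGroup X] [NormedSpace ℝ X]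
    [NormedAddCommGroup Y] [NormedSpace ℝ Y] (A : X →L[ℝ] Y) (f : Y) (v : X) : ℝ≥0∞ :=
  ENNReal.ofReal (1 / 2 * ‖A v - f‖ ^ 2)

/-- The lifted objective `½ ‖A μ(S) - f‖² + α F̂(μ)`. -/
def liftedObjective {S X Y : Type*} [MeasurableSpace S] [NormedAddCommGroup X] [NormedSpace ℝ X]
    [NormedAddCommGroup Y] [NormedSpace ℝ Y] (J : X × S → ℝ≥0∞) (A : X →L[ℝ] Y) (f : Y) (α : ℝ)
    (μ : VMeasure S X) : ℝ≥0∞ :=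
  fidelity A f (μ.1 univ) + ENNReal.ofReal α * liftedFunctional J μ

/-- The objective `½ ‖A I_σ u - f‖² + α F_σ(u)` on pairs `(u, σ)` with `u ∈ L¹((S,σ);X)`. -/
def pairObjective {S X Y : Type*} [MeasurableSpace S] [NormedAddCommGroup X] [NormedSpace ℝ X]
    [NormedAddCommGroup Y] [NormedSpace ℝ Y] (J : X × S → ℝ≥0∞) (A : X →L[ℝ] Y) (f : Y) (α : ℝ)
    (p : (σ : FiniteMeasure S) × Lp X 1 (σ : Measure S)) : ℝ≥0∞ :=
  fidelity A f (integralOp p.1 p.2) + ENNReal.ofReal α * integralFunctional J p.1 p.2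

/-- The objective `½ ‖A v - f‖² + α R(v, σ)` on `X × M₊(S)`. -/
def infConvObjective {S X Y : Type*} [MeasurableSpace S] [NormedAddCommGroup X] [NormedSpace ℝ X]
    [NormedAddCommGroup Y] [NormedSpace ℝ Y] (J : X × S → ℝ≥0∞) (A : X →L[ℝ] Y) (f : Y) (α : ℝ)
    (p : X × FiniteMeasure S) : ℝ≥0∞ :=
  fidelity A f p.1 + ENNReal.ofReal α * infConv J p.1 p.2

end InfConv

end

/-!
The three problems share one compactness argument, carried out for pairs `(u, σ)`.

*Existence for pairs.* By coercivity, a pair competing with `u = 0` has `∫ ‖u‖ dσ ≤ M` for a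
constant `M`. Homogeneity of `J` allows such a pair to be renormalized into the law of
`s ↦ (m u(s) / ‖u(s)‖, s)`, where `m = ∫ ‖u‖ dσ`, under the probability measure `(‖u‖ / m) σ`. This
is a probability measure `ν` on the product of the weak* ball of radius `M` with `S`, and the
objective becomes `½ ‖A ∫ v dν - f‖² + α ∫ J(v, s) dν` (`exists_relaxedObjective_eq`). The product
is compact and metrizable, by the Banach–Alaoglu theorem and because a predual of a separable space
is separable. Hence its probability measures form a compact space, on which the relaxed objective is
lower semicontinuous (`lowerSemicontinuous_relaxedObjective`), and a minimizer `ν` exists. Finally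
`ν` is disintegrated over `S`; with `σ` its marginal and `u(s)` the barycentre of the conditional
measure at `s`, Jensen's inequality shows that `(u, σ)` does at least as well as `ν`
(`exists_pairObjective_le`).

*The lifted problem.* A separable dual space has the Radon–Nikodym property
(`exists_density_variation`): the scalar densities of `⟨μ, p⟩`, for `p` in a dense sequence of the
predual, are for almost every point the values of a functional of norm at most one. So each `μ` has
a density with respect to `|μ|`, and the objective at `μ` is that of the pair `(μ / |μ|, |μ|)`.
Conversely `μ = u σ` has the value of `(u, σ)`, because `|μ| = ‖u‖ σ` and `J` is homogeneous
(`exists_liftedObjective_eq_pairObjective`). Thus a minimizing pair gives a minimizing measure.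

*The problem in `(v, σ)`* is obtained from the pair problem by minimizing over the representations
`v = ∫ u dσ` (`isMinOn_infConvObjective`).
-/

namespace InfConv

/-! ### Separability and measurability in the predual pairing -/

/-- A normed space whose dual is separable is itself separable: vectors almost norming a dense
sequence of functionals span a dense subspace, by the Hahn–Banach theorem. -/
theorem separableSpace_of_separableSpace_strongDual {P : Type*} [NormedAddCommGroup P]
    [NormedSpace ℝ P] [TopologicalSpace.SeparableSpace (StrongDual ℝ P)] :
    TopologicalSpace.SeparableSpace P := by
  let φ := TopologicalSpace.denseSeq (StrongDual ℝ P)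
  have hex : ∀ n, ∃ p : P, ‖p‖ ≤ 1 ∧ ‖φ n‖ / 2 ≤ ‖φ n p‖ := by
    intro n
    by_cases h0 : φ n = 0
    · exact ⟨0, by simp [h0]⟩
    · obtain ⟨p, hp, hlt⟩ := (φ n).exists_lt_apply_of_lt_opNorm
        (half_lt_self (norm_pos_iff.mpr h0))
      exact ⟨p, hp.le, hlt.le⟩
  choose p hp1 hp2 using hex
  let V := Submodule.span ℝ (range p)
  have hsep : TopologicalSpace.IsSeparable (closure (V : Set P)) :=
    ((countable_range p).isSeparable.span).closure
  suffices h : closure (V : Set P) = univ by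
    rw [h] at hsep
    exact TopologicalSpace.isSeparable_univ_iff.mp hsep
  by_contra hne
  obtain ⟨x, hx⟩ := (ne_univ_iff_exists_notMem _).mp hne
  obtain ⟨g, a, hgx, hga⟩ := geometric_hahn_banach_point_closed
    (V.convex.closure) isClosed_closure hx
  -- a functional bounded below on a subspace vanishes there
  have hgV : ∀ v ∈ V, g v = 0 := by
    intro v hv
    by_contra hv0
    have h1 := hga _ (subset_closure (V.smul_mem (a / g v) hv))
    simp [hv0] at h1
  have hg0 : g ≠ 0 := by
    rintro rfl
    have := hga 0 (subset_closure V.zero_mem)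
    simp at hgx this
    linarith
  obtain ⟨n, hn⟩ := (TopologicalSpace.denseRange_denseSeq (StrongDual ℝ P)).exists_dist_lt g
    (show (0 : ℝ) < ‖g‖ / 4 by have := norm_pos_iff.mpr hg0; positivity)
  have h2 : ‖φ n (p n)‖ ≤ ‖g - φ n‖ := by
    have : φ n (p n) = -((g - φ n) (p n)) := by
      simp [hgV _ (Submodule.subset_span (mem_range_self n))]
    rw [this, norm_neg]
    calc _ ≤ ‖g - φ n‖ * ‖p n‖ := (g - φ n).le_opNorm _
      _ ≤ _ := mul_le_of_le_one_right (norm_nonneg _) (hp1 n)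
  have h3 : ‖g‖ ≤ ‖g - φ n‖ + ‖φ n‖ := by simpa using norm_add_le (g - φ n) (φ n)
  have h4 := hp2 n
  rw [dist_eq_norm] at hn
  change ‖g - φ n‖ < _ at hn
  have := norm_pos_iff.mpr hg0
  linarith

section Predual

variable {X P : Type*} [NormedAddCommGroup P] [NormedSpace ℝ P]
  [NormedAddCommGroup X] [NormedSpace ℝ X]

theorem separableSpace_predual [TopologicalSpace.SeparableSpace X] (ι : X ≃ₗᵢ[ℝ] StrongDual ℝ P) :
    TopologicalSpace.SeparableSpace P := by
  have : TopologicalSpace.SeparableSpace (StrongDual ℝ P) :=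
    ι.surjective.denseRange.separableSpace ι.continuous
  exact separableSpace_of_separableSpace_strongDual

theorem continuous_weakStar (ι : X ≃ₗᵢ[ℝ] StrongDual ℝ P) : Continuous (weakStar ι) :=
  NormedSpace.Dual.toWeakDual_continuous.comp ι.continuous

/-- For separable `X`, weak* measurability implies norm measurability: with a dense sequence in
the predual, closed balls are cut out by countably many functionals, and an open set is a
countable union of closed balls. -/
theorem measurable_of_forall_measurable_apply [TopologicalSpace.SeparableSpace X]
    [MeasurableSpace X] [BorelSpace X] {Ω : Type*} [MeasurableSpace Ω]
    (ι : X ≃ₗᵢ[ℝ] StrongDual ℝ P) {u : Ω → X} (hu : ∀ p : P, Measurable fun s => ι (u s) p) :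
    Measurable u := by
  have : TopologicalSpace.SeparableSpace P := separableSpace_predual ι
  have : SecondCountableTopology X := UniformSpace.secondCountable_of_separable X
  have hball : ∀ (c : X) (r : ℝ), 0 < r → MeasurableSet (u ⁻¹' Metric.closedBall c r) := by
    intro c r hr
    have : u ⁻¹' Metric.closedBall c r = ⋂ n, {s | ‖ι (u s) (TopologicalSpace.denseSeq P n) -
        ι c (TopologicalSpace.denseSeq P n)‖ ≤ r * ‖TopologicalSpace.denseSeq P n‖} := by
      ext s
      simp only [mem_preimage, Metric.mem_closedBall, mem_iInter, mem_ofPred_eq]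
      rw [← ι.dist_map, dist_eq_norm, ContinuousLinearMap.opNorm_le_iff hr.le]
      refine ⟨fun h n => h _, fun h p => ?_⟩
      refine (TopologicalSpace.denseRange_denseSeq P).induction_on
        (p := fun p => ‖(ι (u s) - ι c) p‖ ≤ r * ‖p‖) p ?_ h
      exact isClosed_le (by fun_prop) (by fun_prop)
    rw [this]
    exact MeasurableSet.iInter fun n =>
      measurableSet_le ((hu _).sub_const _).norm measurable_const
  refine measurable_of_isOpen fun U hU => ?_
  choose! r hr hrU using fun x (hx : x ∈ U) =>
    Metric.nhds_basis_closedBall.mem_iff.mp (hU.mem_nhds hx)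
  obtain ⟨T, hTU, hTc, hT⟩ := TopologicalSpace.countable_cover_nhdsWithin
    (f := fun x => Metric.closedBall x (r x)) (s := U)
    (fun x hx => mem_nhdsWithin_of_mem_nhds (Metric.closedBall_mem_nhds x (hr x hx)))
  have hUeq : U = ⋃ x ∈ T, Metric.closedBall x (r x) :=
    hT.antisymm (iUnion₂_subset fun x hx => hrU x (hTU hx))
  rw [hUeq, preimage_iUnion₂]
  exact MeasurableSet.biUnion hTc fun x hx => hball _ _ (hr x (hTU hx))

/-- The identity from the weak* topology to the norm topology is Borel measurable when `X` is
separable. -/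
theorem measurable_of_weakStar [TopologicalSpace.SeparableSpace X]
    [MeasurableSpace X] [BorelSpace X] [MeasurableSpace (WeakDual ℝ P)] [BorelSpace (WeakDual ℝ P)]
    (ι : X ≃ₗᵢ[ℝ] StrongDual ℝ P) :
    Measurable fun x : WeakDual ℝ P => ι.symm (WeakDual.toStrongDual x) := by
  refine measurable_of_forall_measurable_apply ι fun p => ?_
  simp only [LinearIsometryEquiv.apply_symm_apply]
  exact (WeakDual.eval_continuous p).measurable

end Predual

/-! ### Lower semicontinuity of integrals and Jensen's inequality -/

/-- In a first countable space sequential lower semicontinuity suffices. -/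
theorem lowerSemicontinuous_of_seq {K : Type*} [TopologicalSpace K] [FirstCountableTopology K]
    {F : K → ℝ≥0∞} (hF : ∀ (z : ℕ → K) (z₀ : K), Tendsto z atTop (𝓝 z₀) →
      F z₀ ≤ liminf (fun n => F (z n)) atTop) : LowerSemicontinuous F := by
  intro z₀ y hy
  by_contra hcon
  obtain ⟨z, hz, hzy⟩ := exists_seq_forall_of_frequently (not_eventually.mp hcon)
  refine absurd ((hF z z₀ hz).trans ?_) (not_le.mpr hy)
  refine liminf_le_of_le (by isBoundedDefault) fun b hb => ?_
  obtain ⟨i, hi⟩ := hb.exists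
  exact hi.trans (not_lt.mp (hzy i))

/-- If `J ≥ 0` is lower semicontinuous, then `ν ↦ ∫ J dν` is lower semicontinuous for weak
convergence. -/
theorem lowerSemicontinuous_lintegral {K : Type*} [TopologicalSpace K]
    [TopologicalSpace.MetrizableSpace K] [SecondCountableTopology K] [MeasurableSpace K]
    [BorelSpace K] {J : K → ℝ≥0∞} (hJ : LowerSemicontinuous J) :
    LowerSemicontinuous fun ν : ProbabilityMeasure K => ∫⁻ x, J x ∂(ν : Measure K) := by
  -- the layer cake formula is for real functions, hence the truncation
  have htrunc : ∀ n : ℕ, LowerSemicontinuous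
      fun ν : ProbabilityMeasure K => ∫⁻ x, min (J x) n ∂(ν : Measure K) := by
    refine fun n => lowerSemicontinuous_of_seq fun νs ν₀ hlim => ?_
    have hmeas : Measurable fun x => min (J x) (n : ℝ≥0∞) := hJ.measurable.min measurable_const
    -- layer cake, together with the portmanteau inequality for the open sets `{J > t}`
    have hlayer : ∀ ν : Measure K, ∫⁻ x, min (J x) n ∂ν =
        ∫⁻ t : ℝ in Ioi 0, ν {x | t < (min (J x) n).toReal} := by
      intro ν
      rw [← lintegral_eq_lintegral_meas_lt ν (Eventually.of_forall fun _ => ENNReal.toReal_nonneg)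
        hmeas.ennreal_toReal.aemeasurable]
      refine lintegral_congr fun x => (ENNReal.ofReal_toReal ?_).symm
      exact ((min_le_right _ _).trans_lt (ENNReal.natCast_lt_top n)).ne
    have hopen : ∀ t : ℝ, 0 < t → IsOpen {x | t < (min (J x) (n : ℝ≥0∞)).toReal} := by
      intro t ht
      have : {x | t < (min (J x) (n : ℝ≥0∞)).toReal} =
          {x | ENNReal.ofReal t < J x} ∩ {_x | ENNReal.ofReal t < n} := by
        ext x
        simp only [mem_ofPred_eq, mem_inter_iff, ← lt_min_iff]
        rw [ENNReal.ofReal_lt_iff_lt_toReal ht.le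
          ((min_le_right _ _).trans_lt (ENNReal.natCast_lt_top n)).ne]
      rw [this]
      exact (hJ.isOpen_preimage _).inter isOpen_const
    simp_rw [hlayer]
    refine le_trans (setLIntegral_mono' measurableSet_Ioi fun t ht =>
      ProbabilityMeasure.le_liminf_measure_open_of_tendsto hlim (hopen t ht)) ?_
    refine lintegral_liminf_le fun i => Antitone.measurable fun s t hst => ?_
    exact measure_mono fun x hx => lt_of_le_of_lt hst hx
  have hsup : (fun ν : ProbabilityMeasure K => ∫⁻ x, J x ∂(ν : Measure K)) =
      fun ν : ProbabilityMeasure K => ⨆ n : ℕ, ∫⁻ x, min (J x) n ∂(ν : Measure K) := by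
    ext ν
    rw [← lintegral_iSup (fun n => hJ.measurable.min measurable_const)
      (fun m n hmn x => min_le_min_left _ (by exact_mod_cast hmn))]
    refine lintegral_congr fun x => ?_
    refine le_antisymm ?_ (iSup_le fun n => min_le_left _ _)
    rcases eq_or_ne (J x) ∞ with h | h
    · simp [h, ENNReal.iSup_natCast]
    · obtain ⟨n, hn⟩ := ENNReal.exists_nat_gt h
      exact le_iSup_of_le n (by simp [hn.le])
  rw [hsup]
  exact lowerSemicontinuous_iSup htrunc

/-- **Jensen's inequality** for extended-valued functions: the mean of `(f, φ ∘ f)` lies in the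
epigraph of `φ`, which is closed and convex. -/
theorem map_integral_le_lintegral {X Ω : Type*} [NormedAddCommGroup X] [NormedSpace ℝ X]
    [CompleteSpace X] [MeasurableSpace Ω] {κ : Measure Ω} [IsProbabilityMeasure κ] {φ : X → ℝ≥0∞}
    (hφ : ConvexOn ℝ≥0 univ φ) (hlsc : LowerSemicontinuous φ) {f : Ω → X} (hf : Integrable f κ)
    (hφf : AEMeasurable (fun ω => φ (f ω)) κ) :
    φ (∫ ω, f ω ∂κ) ≤ ∫⁻ ω, φ (f ω) ∂κ := by
  rcases eq_or_ne (∫⁻ ω, φ (f ω) ∂κ) ∞ with htop | htop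
  · simp [htop]
  let E : Set (X × ℝ) := {p | φ p.1 ≤ ENNReal.ofReal p.2}
  have hEc : IsClosed E := hlsc.isClosed_epigraph.preimage
    (continuous_fst.prodMk (ENNReal.continuous_ofReal.comp continuous_snd))
  -- the constraint `0 ≤ t` is needed because `ENNReal.ofReal` is not additive at negative `t`
  have hEconv : Convex ℝ (E ∩ {p | 0 ≤ p.2}) := by
    rintro ⟨x, s⟩ ⟨hx, hs⟩ ⟨y, t⟩ ⟨hy, ht⟩ a b ha hb hab
    simp only [E, mem_ofPred_eq] at hx hy hs ht
    refine ⟨?_, by simp; positivity⟩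
    lift a to ℝ≥0 using ha
    lift b to ℝ≥0 using hb
    have h := hφ.2 (mem_univ x) (mem_univ y) zero_le zero_le (by exact_mod_cast hab)
    simp only [E, mem_ofPred_eq, Prod.fst_add, Prod.smul_fst, Prod.snd_add, Prod.smul_snd,
      smul_eq_mul]
    rw [ENNReal.ofReal_add (by positivity) (by positivity), ENNReal.ofReal_mul (by positivity),
      ENNReal.ofReal_mul (by positivity), ENNReal.ofReal_coe_nnreal, ENNReal.ofReal_coe_nnreal]
    refine h.trans ?_
    simp only [ENNReal.smul_def, smul_eq_mul]
    gcongr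
  have hfin : ∀ᵐ ω ∂κ, φ (f ω) < ∞ := ae_lt_top' hφf htop
  have hφint : Integrable (fun ω => (φ (f ω)).toReal) κ :=
    integrable_toReal_of_lintegral_ne_top hφf htop
  have hmem := hEconv.integral_mem (μ := κ) (f := fun ω => (f ω, (φ (f ω)).toReal))
    (hEc.inter (isClosed_le continuous_const continuous_snd))
    (hfin.mono fun ω hω => ⟨by simp [E, ENNReal.ofReal_toReal hω.ne], ENNReal.toReal_nonneg⟩)
    (hf.prodMk hφint)
  rw [integral_pair hf hφint, integral_toReal hφf hfin] at hmem
  simpa [E, ENNReal.ofReal_toReal htop] using hmem.1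

/-! ### The Radon–Nikodym property of separable dual spaces -/

section RadonNikodym

variable {X P S : Type*} [NormedAddCommGroup P] [NormedSpace ℝ P]
  [NormedAddCommGroup X] [NormedSpace ℝ X] [MeasurableSpace S]

/-- If `∑ qᵢ gᵢ ≤ ‖∑ qᵢ pᵢ‖` for all rational combinations of a dense sequence `p`, then
`pᵢ ↦ gᵢ` extends to a continuous functional of norm at most one. Only countably many conditions
are imposed, so they can hold simultaneously at almost every point of a measure space. -/
theorem exists_functional_of_rat_bound {p : ℕ → P} (hp : DenseRange p) {g : ℕ → ℝ}
    (hg : ∀ (n : ℕ) (q : Fin n → ℚ), ∑ i, (q i : ℝ) * g i ≤ ‖∑ i, (q i : ℝ) • p i‖) :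
    ∃ φ : StrongDual ℝ P, ‖φ‖ ≤ 1 ∧ ∀ n, φ (p n) = g n := by
  have hreal : ∀ (n : ℕ) (c : Fin n → ℝ), ∑ i, c i * g i ≤ ‖∑ i, c i • p i‖ := by
    intro n c
    have hd : DenseRange fun (q : Fin n → ℚ) (i : Fin n) => (q i : ℝ) :=
      DenseRange.piMap fun _ => Rat.denseRange_cast
    refine hd.induction_on (p := fun c => ∑ i, c i * g i ≤ ‖∑ i, c i • p i‖) c ?_ (hg n)
    exact isClosed_le (by fun_prop) (by fun_prop)
  let e : (ℕ →₀ ℝ) →ₗ[ℝ] P := Finsupp.linearCombination ℝ p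
  let L : (ℕ →₀ ℝ) →ₗ[ℝ] ℝ := Finsupp.linearCombination ℝ g
  have hle : ∀ c, L c ≤ ‖e c‖ := by
    intro c
    obtain ⟨n, hn⟩ := c.support.exists_nat_subset_range
    have h := hreal n fun i => c i
    rw [Fin.sum_univ_eq_sum_range (fun i => c i * g i),
      Fin.sum_univ_eq_sum_range (fun i => c i • p i)] at h
    simp only [L, e, Finsupp.linearCombination_apply]
    rw [Finsupp.sum_of_support_subset c hn (fun i a => a • g i) fun i _ => zero_smul ℝ _,
      Finsupp.sum_of_support_subset c hn (fun i a => a • p i) fun i _ => zero_smul ℝ _]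
    exact h
  have hbound : ∀ c, ‖L c‖ ≤ 1 * ‖e c‖ := by
    intro c
    rw [one_mul, Real.norm_eq_abs, abs_le']
    exact ⟨hle c, by simpa using hle (-c)⟩
  have hdense : DenseRange e := hp.mono (by
    rintro _ ⟨n, rfl⟩
    exact ⟨Finsupp.single n 1, by simp [e]⟩)
  refine ⟨L.extendOfNorm e, ContinuousLinearMap.opNorm_le_bound _ zero_le_one
    (LinearMap.norm_extendOfNorm_apply_le hdense 1 hbound), fun n => ?_⟩
  have := LinearMap.extendOfNorm_eq hdense ⟨1, hbound⟩ (Finsupp.single n 1)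
  simpa [e, L] using this

/-- **Radon–Nikodym theorem** for a measure of finite variation with values in a separable dual
space. The scalar densities of `⟨μ, pₙ⟩` for a dense sequence `pₙ` of the predual assemble, for
almost every point, to an element of the dual. -/
theorem exists_density_variation [CompleteSpace X] [TopologicalSpace.SeparableSpace X]
    [MeasurableSpace X] [BorelSpace X] (ι : X ≃ₗᵢ[ℝ] StrongDual ℝ P) (μ : VectorMeasure S X)
    [IsFiniteMeasure μ.variation] :
    ∃ u : S → X, Integrable u μ.variation ∧
      ∀ E, MeasurableSet E → μ E = ∫ s in E, u s ∂μ.variation := by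
  have : TopologicalSpace.SeparableSpace P := separableSpace_predual ι
  have : SecondCountableTopology X := UniformSpace.secondCountable_of_separable X
  let ν := μ.variation
  obtain ⟨p, hp⟩ := TopologicalSpace.exists_dense_seq P
  let ev (x : P) : X →L[ℝ] ℝ := (ContinuousLinearMap.apply ℝ ℝ x).comp
    (ι.toContinuousLinearEquiv : X →L[ℝ] StrongDual ℝ P)
  have hev : ∀ x v, ev x v = ι v x := fun x v => rfl
  let m (n : ℕ) : SignedMeasure S := μ.mapRange (ev (p n) : X →+ ℝ) (ev (p n)).continuous
  have hm : ∀ n E, m n E = ι (μ E) (p n) := fun n E => rfl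
  let g (n : ℕ) : S → ℝ := (m n).rnDeriv ν
  have hgmeas : ∀ n, Measurable (g n) := fun n => SignedMeasure.measurable_rnDeriv _ _
  have hgint : ∀ n, Integrable (g n) ν := fun n => SignedMeasure.integrable_rnDeriv _ _
  have hgE : ∀ n E, MeasurableSet E → ∫ s in E, g n s ∂ν = ι (μ E) (p n) := by
    intro n E hE
    have hac : m n ≪ᵥ ν.toENNRealVectorMeasure := by
      refine VectorMeasure.AbsolutelyContinuous.mk fun F hF hF0 => ?_
      rw [Measure.toENNRealVectorMeasure_apply_measurable hF] at hF0
      have h0 : ‖μ F‖ₑ ≤ 0 := hF0 ▸ μ.enorm_measure_le_variation F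
      rw [hm, enorm_eq_zero.mp (le_antisymm h0 zero_le)]
      simp
    rw [← withDensityᵥ_apply (hgint n) hE]
    change ν.withDensityᵥ ((m n).rnDeriv ν) E = _
    rw [SignedMeasure.withDensityᵥ_rnDeriv_eq _ _ hac, hm]
  -- `G` is the set where the densities obey the norm bound for all rational combinations
  let G : Set S := ⋂ (n : ℕ) (q : Fin n → ℚ),
    {s | ∑ i, (q i : ℝ) * g i s ≤ ‖∑ i, (q i : ℝ) • p i‖}
  have hGmeas : MeasurableSet G := MeasurableSet.iInter fun n => MeasurableSet.iInter fun q =>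
    measurableSet_le (Finset.measurable_sum _ fun i _ => (hgmeas i).const_mul _) measurable_const
  have hGae : ∀ᵐ s ∂ν, s ∈ G := by
    simp only [G, mem_iInter, mem_ofPred_eq]
    refine ae_all_iff.mpr fun n => ae_all_iff.mpr fun q => ?_
    refine ae_le_of_forall_setIntegral_le (f := fun s => ∑ i, (q i : ℝ) * g i s)
      (g := fun _ => ‖∑ i, (q i : ℝ) • p i‖)
      (integrable_finsetSum _ fun i _ => (hgint i).const_mul _) (integrable_const _)
      fun E hE _ => ?_
    rw [integral_finsetSum _ fun (i : Fin n) _ => ((hgint i).const_mul (q i : ℝ)).integrableOn]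
    simp_rw [integral_const_mul, hgE _ _ hE]
    calc ∑ i, (q i : ℝ) * ι (μ E) (p i) = ι (μ E) (∑ i, (q i : ℝ) • p i) := by simp
      _ ≤ ‖ι (μ E)‖ * ‖∑ i, (q i : ℝ) • p i‖ := (le_abs_self _).trans ((ι (μ E)).le_opNorm _)
      _ ≤ ν.real E * ‖∑ i, (q i : ℝ) • p i‖ := by
        rw [ι.norm_map]
        gcongr
        exact VectorMeasure.norm_measure_le_variation
      _ = ∫ _ in E, ‖∑ i, (q i : ℝ) • p i‖ ∂ν := by simp
  -- setting the functional to `0` off the measurable set `G` keeps it measurable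
  have hφ : ∀ s, ∃ φ : StrongDual ℝ P, ‖φ‖ ≤ 1 ∧ ∀ n, φ (p n) = G.indicator (g n) s := by
    intro s
    by_cases hs : s ∈ G
    · obtain ⟨φ, h1, h2⟩ := exists_functional_of_rat_bound hp (g := fun n => g n s)
        (fun n q => by simpa using mem_iInter.mp (mem_iInter.mp hs n) q)
      exact ⟨φ, h1, fun n => by simp [hs, h2]⟩
    · exact ⟨0, by simp, fun n => by simp [hs]⟩
  choose φ hφ1 hφp using hφ
  let u (s : S) : X := ι.symm (φ s)
  have hu : Measurable u := by
    refine measurable_of_forall_measurable_apply ι fun x => ?_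
    obtain ⟨y, hy, hyx⟩ := mem_closure_iff_seq_limit.mp (hp x)
    choose k hk using hy
    obtain rfl : (fun j => p (k j)) = y := funext hk
    refine measurable_of_tendsto_metrizable (f := fun j s => φ s (p (k j)))
      (fun j => ?_) (tendsto_pi_nhds.mpr fun s => ?_)
    · simp_rw [hφp]
      exact (hgmeas _).indicator hGmeas
    · simpa [u, Function.comp_def] using ((φ s).continuous.tendsto x).comp hyx
  have huint : Integrable u ν := by
    refine Integrable.of_bound hu.aestronglyMeasurable 1 (ae_of_all _ fun s => ?_)
    simpa [u] using hφ1 s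
  refine ⟨u, huint, fun E hE => ?_⟩
  apply ι.injective
  refine DFunLike.ext' (hp.equalizer (map_continuous _) (map_continuous _) ?_)
  funext n
  change ι (μ E) (p n) = ev (p n) (∫ s in E, u s ∂ν)
  rw [← (ev (p n)).integral_comp_comm huint.integrableOn, ← hgE n E hE]
  refine integral_congr_ae (ae_restrict_of_ae (hGae.mono fun s hs => ?_))
  simp [hev, u, hφp, hs]

end RadonNikodym

/-! ### Polar densities -/

section Polar

variable {X P S : Type*} [NormedAddCommGroup P] [NormedSpace ℝ P]
  [NormedAddCommGroup X] [NormedSpace ℝ X] [CompleteSpace X] [MeasurableSpace S]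

theorem existsUnique_isPolarDensity [TopologicalSpace.SeparableSpace X]
    [MeasurableSpace X] [BorelSpace X] (ι : X ≃ₗᵢ[ℝ] StrongDual ℝ P) (μ : VMeasure S X) :
    ∃! u, IsPolarDensity μ u := by
  have : IsFiniteMeasure μ.1.variation := ⟨μ.2⟩
  obtain ⟨u, hu, hμu⟩ := exists_density_variation ι μ.1
  refine ⟨(memLp_one_iff_integrable.mpr hu).toLp u, fun E hE => ?_, fun w hw => ?_⟩
  · rw [hμu E hE]
    refine integral_congr_ae (ae_restrict_of_ae ?_)
    exact (MemLp.coeFn_toLp (memLp_one_iff_integrable.mpr hu)).symm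
  · refine Lp.ext ?_
    refine Filter.EventuallyEq.trans ?_ (MemLp.coeFn_toLp _).symm
    refine (L1.integrable_coeFn w).ae_eq_of_forall_setIntegral_eq _ _ hu fun E hE _ => ?_
    rw [← hw E hE, hμu E hE]
    rfl

theorem isPolarDensity_polarDensity [TopologicalSpace.SeparableSpace X]
    [MeasurableSpace X] [BorelSpace X] (ι : X ≃ₗᵢ[ℝ] StrongDual ℝ P) (μ : VMeasure S X) :
    IsPolarDensity μ (polarDensity μ) := by
  have h : ∃ u, IsPolarDensity μ u := (existsUnique_isPolarDensity ι μ).exists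
  rw [polarDensity, dif_pos h]
  exact h.choose_spec

/-- The lifted objective at `μ` is the value of the pair `(μ / |μ|, |μ|)`. -/
theorem liftedObjective_eq_pairObjective [TopologicalSpace.SeparableSpace X]
    [MeasurableSpace X] [BorelSpace X] (ι : X ≃ₗᵢ[ℝ] StrongDual ℝ P)
    {Y : Type*} [NormedAddCommGroup Y] [NormedSpace ℝ Y] (J : X × S → ℝ≥0∞) (A : X →L[ℝ] Y)
    (f : Y) (α : ℝ) (μ : VMeasure S X) :
    liftedObjective J A f α μ = pairObjective J A f α ⟨μ.absMeasure, polarDensity μ⟩ := by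
  have h := isPolarDensity_polarDensity ι μ univ MeasurableSet.univ
  rw [Measure.restrict_univ] at h
  simp only [liftedObjective, pairObjective, integralOp, ← h]
  rfl

/-- Every pair `(u, σ)` gives a measure `μ = u σ` with the same objective value: `|μ| = ‖u‖ σ`, so
`‖u‖ • (μ / |μ|) = u` holds `σ`-almost everywhere, and `J` is homogeneous. -/
theorem exists_liftedObjective_eq_pairObjective [TopologicalSpace.SeparableSpace X]
    [MeasurableSpace X] [BorelSpace X] (ι : X ≃ₗᵢ[ℝ] StrongDual ℝ P)
    {Y : Type*} [NormedAddCommGroup Y] [NormedSpace ℝ Y] {J : X × S → ℝ≥0∞} (hJ : Measurable J)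
    (hconv : IsConvexHomogeneous J) (A : X →L[ℝ] Y) (f : Y) (α : ℝ)
    (σ : FiniteMeasure S) (u : Lp X 1 (σ : Measure S)) :
    ∃ μ : VMeasure S X, liftedObjective J A f α μ = pairObjective J A f α ⟨σ, u⟩ := by
  have : SecondCountableTopology X := UniformSpace.secondCountable_of_separable X
  have hu : Integrable u (σ : Measure S) := L1.integrable_coeFn u
  have hum : Measurable u := (Lp.stronglyMeasurable u).measurable
  have hvar := Measure.variation_withDensityᵥ hu
  let μ : VMeasure S X := ⟨(σ : Measure S).withDensityᵥ u, by
    rw [hvar, withDensity_apply _ MeasurableSet.univ, Measure.restrict_univ]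
    exact hu.2⟩
  have habs : (μ.absMeasure : Measure S) = (σ : Measure S).withDensity fun s => ‖u s‖ₑ := hvar
  obtain ⟨w, hwm, hwint, hw, hwJ⟩ : ∃ w : S → X, Measurable w ∧
      Integrable w (μ.absMeasure : Measure S) ∧
      (∀ E, MeasurableSet E → μ.1 E = ∫ s in E, w s ∂(μ.absMeasure : Measure S)) ∧
      liftedFunctional J μ = ∫⁻ s, J (w s, s) ∂(μ.absMeasure : Measure S) :=
    ⟨polarDensity μ, (Lp.stronglyMeasurable _).measurable, L1.integrable_coeFn _,
      isPolarDensity_polarDensity ι μ, rfl⟩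
  have hfin : ∀ᵐ s ∂(σ : Measure S), ‖u s‖ₑ < ∞ := ae_of_all _ fun s => enorm_lt_top
  have hae : (fun s => ‖u s‖ • w s) =ᵐ[(σ : Measure S)] u := by
    refine Integrable.ae_eq_of_forall_setIntegral_eq _ _ ?_ hu fun E hE _ => ?_
    · rw [habs, integrable_withDensity_iff_integrable_smul' hum.enorm hfin] at hwint
      simpa using hwint
    · have h1 := hw E hE
      rw [habs, setIntegral_withDensity_eq_setIntegral_toReal_smul hum.enorm
        (ae_restrict_of_ae hfin) _ hE] at h1
      simp only [toReal_enorm] at h1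
      rw [← h1]
      exact withDensityᵥ_apply hu hE
  refine ⟨μ, ?_⟩
  have hfun : liftedFunctional J μ = integralFunctional J σ u := by
    unfold integralFunctional
    have hJw : Measurable fun s => J (w s, s) := hJ.comp (hwm.prodMk measurable_id)
    rw [hwJ, habs, lintegral_withDensity_eq_lintegral_mul _ hum.enorm hJw]
    refine lintegral_congr_ae (hae.mono fun s hs => ?_)
    change ‖u s‖ₑ * J (w s, s) = J (u s, s)
    refine ((hconv s).2.2 ‖u s‖₊ (w s)).symm.trans ?_
    exact congrArg (fun x => J (x, s)) hs
  have hint : μ.1 univ = integralOp σ u := by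
    change (σ : Measure S).withDensityᵥ u univ = _
    rw [withDensityᵥ_apply hu MeasurableSet.univ, Measure.restrict_univ]
    rfl
  simp only [liftedObjective, pairObjective, hfun, hint]

end Polar

/-! ### The relaxed problem on probability measures over a weak* compact set -/

/-- The closed ball of radius `M` of the dual of `P`, with the weak* topology. -/
abbrev WeakBall (P : Type*) [NormedAddCommGroup P] [NormedSpace ℝ P] (M : ℝ) : Type _ :=
  ↥((WeakDual.toStrongDual : WeakDual ℝ P → StrongDual ℝ P) ⁻¹' Metric.closedBall 0 M)

section Relaxed

variable {X P Y S : Type*} [NormedAddCommGroup P] [NormedSpace ℝ P]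
  [NormedAddCommGroup X] [NormedSpace ℝ X]
  [NormedAddCommGroup Y] [InnerProductSpace ℝ Y]

/-- A point of the weak* ball as an element of `X`. -/
noncomputable def WeakBall.toSpace (ι : X ≃ₗᵢ[ℝ] StrongDual ℝ P) {M : ℝ} (b : WeakBall P M) : X :=
  ι.symm (WeakDual.toStrongDual b.1)

theorem WeakBall.norm_toSpace_le (ι : X ≃ₗᵢ[ℝ] StrongDual ℝ P) {M : ℝ} (b : WeakBall P M) :
    ‖b.toSpace ι‖ ≤ M := by
  have := b.2
  rw [mem_preimage, mem_closedBall_zero_iff] at this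
  simpa [WeakBall.toSpace] using this

theorem WeakBall.weakStar_toSpace (ι : X ≃ₗᵢ[ℝ] StrongDual ℝ P) {M : ℝ} (b : WeakBall P M) :
    weakStar ι (b.toSpace ι) = b.1 := by
  simp [weakStar, WeakBall.toSpace]

/-- A vector of norm at most `M` as a point of the weak* ball. -/
noncomputable def WeakBall.ofSpace (ι : X ≃ₗᵢ[ℝ] StrongDual ℝ P) {M : ℝ} (x : X) (hx : ‖x‖ ≤ M) :
    WeakBall P M :=
  ⟨weakStar ι x, by
    rw [mem_preimage, mem_closedBall_zero_iff]
    simpa [weakStar] using hx⟩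

@[simp]
theorem WeakBall.toSpace_ofSpace (ι : X ≃ₗᵢ[ℝ] StrongDual ℝ P) {M : ℝ} (x : X) (hx : ‖x‖ ≤ M) :
    (WeakBall.ofSpace ι x hx).toSpace ι = x := by
  simp [WeakBall.ofSpace, WeakBall.toSpace, weakStar]

instance WeakBall.instCompactSpace (M : ℝ) : CompactSpace (WeakBall P M) :=
  isCompact_iff_compactSpace.mp (WeakDual.isCompact_closedBall _ _)

theorem WeakBall.metrizableSpace [TopologicalSpace.SeparableSpace P] (M : ℝ) :
    TopologicalSpace.MetrizableSpace (WeakBall P M) :=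
  WeakDual.metrizable_of_isCompact ℝ P _ (WeakDual.isCompact_closedBall _ _)

variable [TopologicalSpace.SeparableSpace X] [MeasurableSpace X] [BorelSpace X]
  [MeasurableSpace (WeakDual ℝ P)] [BorelSpace (WeakDual ℝ P)] [MeasurableSpace S]

theorem WeakBall.measurable_toSpace (ι : X ≃ₗᵢ[ℝ] StrongDual ℝ P) (M : ℝ) :
    Measurable (WeakBall.toSpace ι : WeakBall P M → X) :=
  (measurable_of_weakStar ι).comp measurable_subtype_coe

/-- The relaxed objective `½ ‖A ∫ v dν - f‖² + α ∫ J(v, s) dν(v, s)` of a probability measure `ν`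
on the product of the weak* ball with `S`. -/
noncomputable def relaxedObjective (ι : X ≃ₗᵢ[ℝ] StrongDual ℝ P) (J : X × S → ℝ≥0∞) (A : X →L[ℝ] Y)
    (f : Y) (α : ℝ) {M : ℝ} (ν : ProbabilityMeasure (WeakBall P M × S)) : ℝ≥0∞ :=
  fidelity A f (∫ z, z.1.toSpace ι ∂(ν : Measure (WeakBall P M × S))) +
    ENNReal.ofReal α * ∫⁻ z, J (z.1.toSpace ι, z.2) ∂(ν : Measure (WeakBall P M × S))

theorem integrable_toSpace (ι : X ≃ₗᵢ[ℝ] StrongDual ℝ P) {M : ℝ}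
    (ν : ProbabilityMeasure (WeakBall P M × S)) :
    Integrable (fun z : WeakBall P M × S => z.1.toSpace ι) (ν : Measure (WeakBall P M × S)) := by
  have : SecondCountableTopology X := UniformSpace.secondCountable_of_separable X
  exact Integrable.of_bound
    ((WeakBall.measurable_toSpace ι M).comp measurable_fst).aestronglyMeasurable M
    (ae_of_all _ fun z => WeakBall.norm_toSpace_le ι z.1)

/-- A pair `(u, σ)` with `m = ∫ ‖u‖ dσ ≤ M` has the same objective value as the law of
`s ↦ (m u(s) / ‖u(s)‖, s)` under the probability measure `(‖u‖ / m) σ`. -/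
theorem exists_relaxedObjective_eq [CompleteSpace X] [Nonempty S] (ι : X ≃ₗᵢ[ℝ] StrongDual ℝ P)
    {J : X × S → ℝ≥0∞} (hJ : Measurable J) (hconv : IsConvexHomogeneous J)
    (A : X →L[ℝ] Y) (f : Y) (α : ℝ) {M : ℝ} (σ : FiniteMeasure S) (u : Lp X 1 (σ : Measure S))
    (hu : ∫ s, ‖u s‖ ∂(σ : Measure S) ≤ M) :
    ∃ ν : ProbabilityMeasure (WeakBall P M × S),
      relaxedObjective ι J A f α ν = pairObjective J A f α ⟨σ, u⟩ := by
  have : SecondCountableTopology X := UniformSpace.secondCountable_of_separable X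
  have hui : Integrable u (σ : Measure S) := L1.integrable_coeFn u
  have hum : Measurable u := (Lp.stronglyMeasurable u).measurable
  have hJ0 : ∀ s, J (0, s) = 0 := fun s => by simpa using (hconv s).2.2 0 0
  have hJm : Measurable fun z : WeakBall P M × S => J (z.1.toSpace ι, z.2) :=
    hJ.comp (((WeakBall.measurable_toSpace ι M).comp measurable_fst).prodMk measurable_snd)
  have hTm : Measurable fun z : WeakBall P M × S => z.1.toSpace ι :=
    (WeakBall.measurable_toSpace ι M).comp measurable_fst
  let m : ℝ := ∫ s, ‖u s‖ ∂(σ : Measure S)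
  have hm0 : 0 ≤ m := integral_nonneg fun s => norm_nonneg _
  rcases hm0.eq_or_lt with hm | hm
  -- if `u = 0` almost everywhere, the Dirac measure at any point `(0, s₀)` has the same value
  · have hu0 : u =ᵐ[(σ : Measure S)] 0 := by
      have := (integral_eq_zero_iff_of_nonneg (fun s => norm_nonneg _) hui.norm).mp hm.symm
      exact this.mono fun s hs => by simpa using hs
    obtain ⟨s₀⟩ := ‹Nonempty S›
    let z₀ : WeakBall P M × S := (WeakBall.ofSpace ι 0 (by simpa using hm0.trans hu), s₀)
    refine ⟨⟨Measure.dirac z₀, inferInstance⟩, ?_⟩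
    have h1 : integralOp σ u = 0 := integral_eq_zero_of_ae hu0
    have h2 : integralFunctional J σ u = 0 := by
      unfold integralFunctional
      rw [lintegral_congr_ae (g := fun _ => 0) (hu0.mono fun s hs => by simp [hs, hJ0])]
      simp
    have h3 : ∫ z, z.1.toSpace ι ∂(Measure.dirac z₀) = (0 : X) := by
      rw [integral_dirac' _ _ hTm.stronglyMeasurable]
      simp [z₀]
    simp only [relaxedObjective, pairObjective, h1, h2, ProbabilityMeasure.coe_mk, h3]
    rw [lintegral_dirac' _ hJm]
    simp [z₀, hJ0]
  -- where `u s = 0`, division by zero makes `w s = 0`, and `π` has zero density there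
  · let w (s : S) : X := (m / ‖u s‖) • u s
    have hwm : Measurable w := (measurable_const.div hum.norm).smul hum
    have hwM : ∀ s, ‖w s‖ ≤ M := by
      intro s
      rw [norm_smul, norm_div, norm_norm, Real.norm_of_nonneg hm0]
      refine le_trans ?_ hu
      rcases eq_or_ne ‖u s‖ 0 with h | h
      · simpa [h] using hm0
      · rw [div_mul_cancel₀ _ h]
    let π : Measure S := (σ : Measure S).withDensity fun s => ‖u s‖ₑ / ENNReal.ofReal m
    have hdm : Measurable fun s => ‖u s‖ₑ / ENNReal.ofReal m := hum.enorm.div_const _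
    have hdfin : ∀ᵐ s ∂(σ : Measure S), ‖u s‖ₑ / ENNReal.ofReal m < ∞ := ae_of_all _ fun s =>
      ENNReal.div_lt_top enorm_ne_top (by simpa using hm)
    have hπ : IsProbabilityMeasure π := by
      constructor
      simp only [π, withDensity_apply _ MeasurableSet.univ, Measure.restrict_univ,
        div_eq_mul_inv]
      rw [lintegral_mul_const _ hum.enorm, ← ofReal_integral_norm_eq_lintegral_enorm hui]
      exact ENNReal.mul_inv_cancel (by simpa using hm) ENNReal.ofReal_ne_top
    let F (s : S) : WeakBall P M × S := (WeakBall.ofSpace ι (w s) (hwM s), s)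
    have hF : Measurable F :=
      (((continuous_weakStar ι).measurable.comp hwm).subtype_mk).prodMk measurable_id
    refine ⟨⟨π.map F, Measure.isProbabilityMeasure_map hF.aemeasurable⟩, ?_⟩
    have hdr : ∀ s, (‖u s‖ₑ / ENNReal.ofReal m).toReal • w s = u s := by
      intro s
      by_cases hs : u s = 0
      · simp [w, hs]
      · have : ‖u s‖ ≠ 0 := norm_ne_zero_iff.mpr hs
        rw [ENNReal.toReal_div, toReal_enorm, ENNReal.toReal_ofReal hm0, smul_smul]
        rw [div_mul_div_cancel₀ hm.ne', div_self this, one_smul]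
    have h1 : ∫ z, z.1.toSpace ι ∂(π.map F) = integralOp σ u := by
      rw [integral_map hF.aemeasurable hTm.aestronglyMeasurable]
      simp only [F, WeakBall.toSpace_ofSpace, π]
      rw [integral_withDensity_eq_integral_toReal_smul hdm hdfin]
      simp only [hdr]
      rfl
    have h2 : ∫⁻ z, J (z.1.toSpace ι, z.2) ∂(π.map F) = integralFunctional J σ u := by
      rw [lintegral_map hJm hF]
      simp only [F, WeakBall.toSpace_ofSpace, π]
      have hJw : Measurable fun s => J (w s, s) := hJ.comp (hwm.prodMk measurable_id)
      rw [lintegral_withDensity_eq_lintegral_mul _ hdm hJw]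
      refine lintegral_congr_ae (hdfin.mono fun s hs => ?_)
      have := (hconv s).2.2 (‖u s‖ₑ / ENNReal.ofReal m).toNNReal (w s)
      rw [ENNReal.coe_toNNReal hs.ne] at this
      change ‖u s‖ₑ / ENNReal.ofReal m * J (w s, s) = J (u s, s)
      rw [← this]
      congr 2
      exact hdr s
    simp only [relaxedObjective, pairObjective, ProbabilityMeasure.coe_mk, h1, h2]

/-- Disintegrating `ν` over `S` and replacing each conditional measure by its barycentre produces a
pair `(u, σ)`; by Jensen's inequality the objective does not increase. -/
theorem exists_pairObjective_le [CompleteSpace X] (ι : X ≃ₗᵢ[ℝ] StrongDual ℝ P)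
    [TopologicalSpace S] {J : X × S → ℝ≥0∞} (hJ : Measurable J) (hconv : IsConvexHomogeneous J)
    (hlsc : IsWeakStarSeqLSC ι J) (A : X →L[ℝ] Y) (f : Y) (α : ℝ) {M : ℝ}
    (ν : ProbabilityMeasure (WeakBall P M × S)) :
    ∃ (σ : FiniteMeasure S) (u : Lp X 1 (σ : Measure S)),
      pairObjective J A f α ⟨σ, u⟩ ≤ relaxedObjective ι J A f α ν := by
  have : SecondCountableTopology X := UniformSpace.secondCountable_of_separable X
  let T (z : WeakBall P M × S) : S × X := (z.2, z.1.toSpace ι)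
  have hT : Measurable T :=
    measurable_snd.prodMk ((WeakBall.measurable_toSpace ι M).comp measurable_fst)
  let ρ : Measure (S × X) := (ν : Measure (WeakBall P M × S)).map T
  have : IsProbabilityMeasure ρ := Measure.isProbabilityMeasure_map hT.aemeasurable
  have hint : Integrable (Prod.snd : S × X → X) ρ := by
    refine (integrable_map_measure measurable_snd.aestronglyMeasurable hT.aemeasurable).mpr ?_
    exact integrable_toSpace ι ν
  let σ : FiniteMeasure S := ⟨ρ.fst, inferInstance⟩
  let v (s : S) : X := ∫ x, x ∂(ρ.condKernel s)
  have hv : Integrable v ρ.fst := hint.integral_condKernel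
  have hvL := memLp_one_iff_integrable.mpr hv
  refine ⟨σ, hvL.toLp v, ?_⟩
  have hae : hvL.toLp v =ᵐ[ρ.fst] v := hvL.coeFn_toLp
  have h1 : integralOp σ (hvL.toLp v) = ∫ z, z.1.toSpace ι ∂(ν : Measure (WeakBall P M × S)) := by
    unfold integralOp
    change ∫ s, hvL.toLp v s ∂ρ.fst = _
    rw [integral_congr_ae hae, Measure.integral_condKernel hint,
      integral_map hT.aemeasurable measurable_snd.aestronglyMeasurable]
  have hJ' : Measurable fun z : S × X => J (z.2, z.1) := hJ.comp measurable_swap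
  have h2 : integralFunctional J σ (hvL.toLp v) ≤
      ∫⁻ z, J (z.1.toSpace ι, z.2) ∂(ν : Measure (WeakBall P M × S)) := by
    unfold integralFunctional
    change ∫⁻ s, J (hvL.toLp v s, s) ∂ρ.fst ≤ _
    have h3 : ∫⁻ z, J (z.1.toSpace ι, z.2) ∂(ν : Measure (WeakBall P M × S)) =
        ∫⁻ z, J (z.2, z.1) ∂ρ := (lintegral_map hJ' hT).symm
    rw [h3, ← Measure.lintegral_condKernel hJ']
    refine lintegral_mono_ae ?_
    filter_upwards [hae, hint.condKernel_ae] with s hs hsi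
    rw [hs]
    refine map_integral_le_lintegral (φ := fun x => J (x, s)) (hconv s).2.1 ?_ hsi
      (hJ.comp (measurable_id.prodMk measurable_const)).aemeasurable
    refine lowerSemicontinuous_of_seq fun z z₀ hz => ?_
    exact hlsc z (fun _ => s) z₀ s (((continuous_weakStar ι).tendsto z₀).comp hz)
      tendsto_const_nhds
  simp only [pairObjective, relaxedObjective, h1]
  gcongr

variable [TopologicalSpace S] [CompactSpace S] [TopologicalSpace.MetrizableSpace S] [BorelSpace S]

/-- The fidelity term is lower semicontinuous, being a supremum of the continuous functions
`ν ↦ ⟪A ∫ v dν - f, y⟫ - ½ ‖y‖²`, in which `v ↦ ⟪A v, y⟫` is weak* continuous. -/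
theorem lowerSemicontinuous_fidelity_integral [CompleteSpace X] [CompleteSpace Y]
    (ι : X ≃ₗᵢ[ℝ] StrongDual ℝ P)
    (A : X →L[ℝ] Y) (hA : IsWeakStarWeakContinuous ι A) (f : Y) (M : ℝ) :
    LowerSemicontinuous fun ν : ProbabilityMeasure (WeakBall P M × S) =>
      fidelity A f (∫ z, z.1.toSpace ι ∂(ν : Measure (WeakBall P M × S))) := by
  intro ν₀ t ht
  let bar (ν : ProbabilityMeasure (WeakBall P M × S)) : X :=
    ∫ z, z.1.toSpace ι ∂(ν : Measure (WeakBall P M × S))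
  -- the supremum over `y` is attained at `ν₀` for this `y`
  let y : Y := A (bar ν₀) - f
  let h (ν : ProbabilityMeasure (WeakBall P M × S)) : ℝ :=
    inner ℝ y (A (bar ν) - f) - 1 / 2 * ‖y‖ ^ 2
  have hcont : Continuous fun b : WeakBall P M => inner ℝ y (A (b.toSpace ι)) := by
    have h1 : Continuous fun w : WeakSpace ℝ Y => inner ℝ y ((toWeakSpace ℝ Y).symm w) :=
      WeakBilin.eval_continuous (topDualPairing ℝ Y).flip (innerSL ℝ y)
    exact (h1.comp hA).comp continuous_subtype_val
  have hh : Continuous h := by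
    let g : BoundedContinuousFunction (WeakBall P M × S) ℝ :=
      BoundedContinuousFunction.mkOfCompact ⟨_, hcont.comp continuous_fst⟩
    have heq : ∀ ν, h ν = ∫ z, g z ∂(ν : Measure (WeakBall P M × S)) -
        inner ℝ y f - 1 / 2 * ‖y‖ ^ 2 := by
      intro ν
      have := ((innerSL ℝ y).comp A).integral_comp_comm (integrable_toSpace ι ν)
      simp only [h, inner_sub_right]
      congr 2
      exact this.symm
    rw [funext heq]
    exact ((ProbabilityMeasure.continuous_integral_boundedContinuousFunction g).sub
      continuous_const).sub continuous_const
  have hle : ∀ ν, h ν ≤ 1 / 2 * ‖A (bar ν) - f‖ ^ 2 := by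
    intro ν
    have := real_inner_le_norm y (A (bar ν) - f)
    simp only [h]
    nlinarith [sq_nonneg (‖y‖ - ‖A (bar ν) - f‖)]
  have h0 : h ν₀ = 1 / 2 * ‖A (bar ν₀) - f‖ ^ 2 := by
    simp only [h, y, real_inner_self_eq_norm_sq]
    ring
  have ht' : t < ENNReal.ofReal (h ν₀) := h0 ▸ ht
  filter_upwards [((ENNReal.continuous_ofReal.comp hh).tendsto ν₀).eventually_const_lt ht']
    with ν hν
  exact hν.trans_le (ENNReal.ofReal_le_ofReal (hle ν))

theorem lowerSemicontinuous_relaxedObjective [CompleteSpace X] [CompleteSpace Y]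
    (ι : X ≃ₗᵢ[ℝ] StrongDual ℝ P) {J : X × S → ℝ≥0∞} (hlsc : IsWeakStarSeqLSC ι J)
    (A : X →L[ℝ] Y) (hA : IsWeakStarWeakContinuous ι A) (f : Y) (α : ℝ) (M : ℝ) :
    LowerSemicontinuous (relaxedObjective ι J A f α (M := M)) := by
  have : TopologicalSpace.SeparableSpace P := separableSpace_predual ι
  have : TopologicalSpace.MetrizableSpace (WeakBall P M) := WeakBall.metrizableSpace M
  have hJ : LowerSemicontinuous fun z : WeakBall P M × S => J (z.1.toSpace ι, z.2) := by
    refine lowerSemicontinuous_of_seq fun z z₀ hz => ?_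
    refine hlsc (fun n => (z n).1.toSpace ι) (fun n => (z n).2) _ _ ?_
      ((continuous_snd.tendsto z₀).comp hz)
    simp only [WeakBall.weakStar_toSpace]
    exact ((continuous_subtype_val.comp continuous_fst).tendsto z₀).comp hz
  refine (lowerSemicontinuous_fidelity_integral ι A hA f M).add ?_
  exact (ENNReal.continuous_const_mul ENNReal.ofReal_ne_top).comp_lowerSemicontinuous
    (lowerSemicontinuous_lintegral hJ) fun _ _ h => mul_le_mul_right h _

/-- The problem in `(u, σ)` has a minimizer. -/
theorem exists_isMinOn_pairObjective [CompleteSpace X] [CompleteSpace Y] [Nonempty S]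
    (ι : X ≃ₗᵢ[ℝ] StrongDual ℝ P)
    {J : X × S → ℝ≥0∞} (hJ : Measurable J) (hconv : IsConvexHomogeneous J)
    (hlsc : IsWeakStarSeqLSC ι J) (hcoer : IsCoercive J)
    (A : X →L[ℝ] Y) (hA : IsWeakStarWeakContinuous ι A) (f : Y) {α : ℝ} (hα : 0 < α) :
    ∃ (σ : FiniteMeasure S) (u : Lp X 1 (σ : Measure S)),
      IsMinOn (pairObjective J A f α) univ ⟨σ, u⟩ := by
  obtain ⟨C, hC, hCJ⟩ := hcoer
  -- a pair doing at least as well as `u = 0` has `∫ ‖u‖ dσ ≤ M`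
  let E₀ : ℝ≥0∞ := fidelity A f 0
  let M : ℝ := (C * (E₀ / ENNReal.ofReal α)).toReal
  have hαpos : ENNReal.ofReal α ≠ 0 := by simpa using hα
  have hMfin : C * (E₀ / ENNReal.ofReal α) ≠ ∞ :=
    ENNReal.mul_ne_top ENNReal.coe_ne_top (ENNReal.div_ne_top ENNReal.ofReal_ne_top hαpos)
  have hbound : ∀ (σ : FiniteMeasure S) (u : Lp X 1 (σ : Measure S)),
      pairObjective J A f α ⟨σ, u⟩ ≤ E₀ → ∫ s, ‖u s‖ ∂(σ : Measure S) ≤ M := by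
    intro σ u h
    have h1 : integralFunctional J σ u ≤ E₀ / ENNReal.ofReal α := by
      rw [ENNReal.le_div_iff_mul_le (Or.inl hαpos) (Or.inl ENNReal.ofReal_ne_top), mul_comm]
      exact le_add_self.trans h
    rw [integral_norm_eq_lintegral_enorm (L1.integrable_coeFn u).aestronglyMeasurable]
    refine ENNReal.toReal_mono hMfin ?_
    calc ∫⁻ s, ‖u s‖ₑ ∂(σ : Measure S) ≤ ∫⁻ s, C * J (u s, s) ∂(σ : Measure S) :=
          lintegral_mono fun s => hCJ _ _
      _ = C * integralFunctional J σ u := lintegral_const_mul' _ _ ENNReal.coe_ne_top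
      _ ≤ _ := by gcongr
  have hzero : pairObjective J A f α ⟨(0 : FiniteMeasure S), 0⟩ = E₀ := by
    simp [pairObjective, integralOp, integralFunctional, E₀]
  obtain ⟨ν₁, hν₁⟩ := exists_relaxedObjective_eq ι hJ hconv A f α 0 0 (hbound 0 0 hzero.le)
  obtain ⟨ν, -, hν⟩ := LowerSemicontinuousOn.exists_isMinOn ⟨ν₁, mem_univ _⟩ isCompact_univ
    ((lowerSemicontinuous_relaxedObjective ι hlsc A hA f α M).lowerSemicontinuousOn univ)
  obtain ⟨σ, u, hu⟩ := exists_pairObjective_le ι hJ hconv hlsc A f α ν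
  have hle : ∀ (τ : FiniteMeasure S) (w : Lp X 1 (τ : Measure S)),
      pairObjective J A f α ⟨τ, w⟩ ≤ E₀ →
      pairObjective J A f α ⟨σ, u⟩ ≤ pairObjective J A f α ⟨τ, w⟩ := by
    intro τ w h
    obtain ⟨ν', hν'⟩ := exists_relaxedObjective_eq ι hJ hconv A f α τ w (hbound τ w h)
    rw [← hν']
    exact hu.trans (hν (mem_univ ν'))
  refine ⟨σ, u, ?_⟩
  rintro ⟨τ, w⟩ -
  by_cases h : pairObjective J A f α ⟨τ, w⟩ ≤ E₀
  · exact hle τ w h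
  · exact (hle 0 0 hzero.le).trans (hzero.le.trans (not_le.mp h).le)

end Relaxed

/-! ### The problem in `(v, σ)` -/

/-- `R(·, σ)` is the infimum of `F_σ` over the representations of `v`, so minimizing the pair
objective is minimizing the objective with `R` over the representations as well. -/
theorem isMinOn_infConvObjective {X S Y : Type*} [MeasurableSpace S] [NormedAddCommGroup X]
    [NormedSpace ℝ X] [NormedAddCommGroup Y] [NormedSpace ℝ Y] {J : X × S → ℝ≥0∞}
    {A : X →L[ℝ] Y} {f : Y} {α : ℝ} (hα : 0 < α) {σ : FiniteMeasure S} {u : Lp X 1 (σ : Measure S)}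
    (h : IsMinOn (pairObjective J A f α) univ ⟨σ, u⟩) :
    IsMinOn (infConvObjective J A f α) univ (integralOp σ u, σ) := by
  refine isMinOn_univ_iff.mpr ?_
  rintro ⟨v, τ⟩
  have hle : infConvObjective J A f α (integralOp σ u, σ) ≤ pairObjective J A f α ⟨σ, u⟩ := by
    unfold infConvObjective pairObjective infConv
    refine add_le_add le_rfl (mul_le_mul_right ?_ _)
    exact iInf₂_le (f := fun (w : Lp X 1 (σ : Measure S)) (_ : integralOp σ w = integralOp σ u) =>
      integralFunctional J σ w) u rfl
  have hα' : ENNReal.ofReal α ≠ 0 := by simpa using hα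
  have heq : infConvObjective J A f α (v, τ) = ⨅ w : {w : Lp X 1 (τ : Measure S) //
      integralOp τ w = v}, fidelity A f v + ENNReal.ofReal α * integralFunctional J τ w := by
    rw [← ENNReal.add_iInf, ← ENNReal.mul_iInf_of_ne hα' ENNReal.ofReal_ne_top]
    simp only [infConvObjective, infConv, iInf_subtype]
  have hpair : ∀ w : {w : Lp X 1 (τ : Measure S) // integralOp τ w = v},
      pairObjective J A f α ⟨σ, u⟩ ≤
        fidelity A f v + ENNReal.ofReal α * integralFunctional J τ w := by
    rintro ⟨w, rfl⟩
    exact isMinOn_univ_iff.mp h ⟨τ, w⟩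
  rw [heq]
  exact hle.trans (le_iInf hpair)

end InfConv

theorem mainTheorem1
    {X P Y : Type*}
    [NormedAddCommGroup P] [NormedSpace ℝ P] [CompleteSpace P]
    [NormedAddCommGroup X] [NormedSpace ℝ X] [CompleteSpace X]
    [TopologicalSpace.SeparableSpace X] [MeasurableSpace X] [BorelSpace X]
    [NormedAddCommGroup Y] [InnerProductSpace ℝ Y] [CompleteSpace Y]
    [TopologicalSpace.SeparableSpace Y]
    (ι : X ≃ₗᵢ[ℝ] StrongDual ℝ P)
    (A : X →L[ℝ] Y) (hA : InfConv.IsWeakStarWeakContinuous ι A)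
    (d : ℕ) (S : Set (EuclideanSpace ℝ (Fin d))) (hS : IsCompact S) (hSne : S.Nonempty)
    (J : X × S → ℝ≥0∞) (hJmeas : Measurable J)
    (hconv : InfConv.IsConvexHomogeneous J)
    (hlsc : InfConv.IsWeakStarSeqLSC ι J)
    (hcoer : InfConv.IsCoercive J)
    (f : Y) (α : ℝ) (hα : 0 < α) :
    -- the density of every measure with respect to its variation exists and is unique
    (∀ μ : InfConv.VMeasure S X, ∃! u, InfConv.IsPolarDensity μ u) ∧
    -- the lifted problem has a minimizer
    (∃ μ : InfConv.VMeasure S X, IsMinOn (InfConv.liftedObjective J A f α) univ μ) ∧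
    -- the problem in `(u, σ)` has a minimizer
    (∃ (σ : FiniteMeasure S) (u : Lp X 1 (σ : Measure S)),
      IsMinOn (InfConv.pairObjective J A f α) univ ⟨σ, u⟩) ∧
    -- each such minimizer yields a minimizer of the problem in `(v, σ)`
    (∀ (σ : FiniteMeasure S) (u : Lp X 1 (σ : Measure S)),
      IsMinOn (InfConv.pairObjective J A f α) univ ⟨σ, u⟩ →
      IsMinOn (InfConv.infConvObjective J A f α) univ (InfConv.integralOp σ u, σ)) := by
  have : CompactSpace S := isCompact_iff_compactSpace.mp hS
  have : Nonempty S := hSne.to_subtype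
  borelize (WeakDual ℝ P)
  obtain ⟨σ, u, hmin⟩ :=
    InfConv.exists_isMinOn_pairObjective ι hJmeas hconv hlsc hcoer A hA f hα
  refine ⟨InfConv.existsUnique_isPolarDensity ι, ?_, ⟨σ, u, hmin⟩,
    fun σ u h => InfConv.isMinOn_infConvObjective hα h⟩
  obtain ⟨μ, hμ⟩ := InfConv.exists_liftedObjective_eq_pairObjective ι hJmeas hconv A f α σ u
  refine ⟨μ, fun μ' _ => ?_⟩
  change InfConv.liftedObjective J A f α μ ≤ InfConv.liftedObjective J A f α μ'
  rw [hμ, InfConv.liftedObjective_eq_pairObjective ι]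
  exact hmin (mem_univ _)
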